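/- Let $R$ be an associative ring with identity, not necessarily commutative. Modules are unital left $R$-modules unless stated otherwise. For a right $R$-module $G$, let $G^+=\operatorname{Hom}_{\mathbb Z}(G,\mathbb Q/\mathbb Z)$ be its character module, a left $R$-module via $(rc)(g)=c(gr)$. A short exact sequence $0\to A\to B\to C\to 0$ of modules is called *coneat exact* if it remains exact after applying $G\otimes_R-$ for every simple right $R$-module $G$. A sequence $0\to A\xrightarrow{f}B$ is called coneat exact if $0\to A\xrightarrow{f}B\to B/f(A)\to 0$ is coneat exact, and a submodule $A\subseteq B$ is called a *coneat submodule* if $0\to A\hookrightarrow B\to B/A\to 0$ is coneat exact. A module $M$ is *injective with respect to* $f:A\to B$ if every homomorphism $A\to M$ factors through $f$. A module is called *coneat injective* if it is isomorphic to a direct summand of a product of copies of modules $(R/I)^+$, where each $I$ is a maximal right ideal of $R$ or the zero ideal. A *coneat injective envelope* of a module $M$ is a homomorphism $\varphi:M\to E$ with $E$ coneat injective such that every homomorphism from $M$ to a coneat injective module factors through $\varphi$, and such that every endomorphism $f$ of $E$ with $f\varphi=\varphi$ is an automorphism. **Theorem.** 0. A module is coneat injective if and only if it is isomorphic to a direct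 summand of a product $\prod_i G_i^+$, where each $G_i$ is a right $R$-module that is either simple or isomorphic to $R_R$. 1. A module $M$ is coneat injective if and only if it is injective with respect to all coneat exact sequences, that is, with respect to $f$ for every coneat exact sequence $0\to A\xrightarrow{f}B\to C\to 0$. 2. For a homomorphism $f:A\to B$ of modules, the sequence $0\to A\xrightarrow{f}B$ is coneat exact if and only if every coneat injective module is injective with respect to $f$. 3. Every module $M$ has a coneat injective envelope $\varphi:M\to \mathrm{CE}(M)$. It is unique up to isomorphism: for any two coneat injective envelopes $\varphi:M\to E$ and $\varphi':M\to E'$ there is an isomorphism $e:E\to E'$ with $e\varphi=\varphi'$. Moreover, for every coneat injective envelope $\varphi:M\to E$, the map $\varphi$ is injective and $\varphi(M)$ is a coneat submodule of $E$. -/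

import Mathlib

open scoped TensorProduct

universe u v w w₁ w₂ w₃

namespace Coneat

/-! Left modules over `R` are `Module R A`; right modules over `R` are `Module Rᵐᵒᵖ G`, with
`MulOpposite.op r • g` standing for `g r`. -/

/-- The subgroup of `G ⊗[ℤ] A` generated by all `(g r) ⊗ a - g ⊗ (r a)`. -/
def balancedRel (R : Type u) [Ring R] (G : Type w₁) [AddCommGroup G] [Module Rᵐᵒᵖ G]
    (A : Type w₂) [AddCommGroup A] [Module R A] : AddSubgroup (G ⊗[ℤ] A) :=
  AddSubgroup.closure
    {x | ∃ (g : G) (r : R) (a : A), x = (MulOpposite.op r • g) ⊗ₜ[ℤ] a - g ⊗ₜ[ℤ] (r • a)}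

/-- The tensor product `G ⊗_R A` of a right module `G` and a left module `A` over a (not
necessarily commutative) ring `R`; it is an abelian group. -/
abbrev Tensor (R : Type u) [Ring R] (G : Type w₁) [AddCommGroup G] [Module Rᵐᵒᵖ G]
    (A : Type w₂) [AddCommGroup A] [Module R A] : Type (max w₁ w₂) :=
  (G ⊗[ℤ] A) ⧸ balancedRel R G A

section Map

variable {R : Type u} [Ring R] (G : Type w₁) [AddCommGroup G] [Module Rᵐᵒᵖ G]
  {A : Type w₂} [AddCommGroup A] [Module R A] {B : Type w₃} [AddCommGroup B] [Module R B]

theorem balancedRel_le_comap (f : A →ₗ[R] B) :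
    balancedRel R G A ≤
      (balancedRel R G B).comap (f.toAddMonoidHom.toIntLinearMap.lTensor G).toAddMonoidHom := by
  refine (AddSubgroup.closure_le _).2 ?_
  rintro _ ⟨g, r, a, rfl⟩
  refine AddSubgroup.subset_closure ⟨g, r, f a, ?_⟩
  simp

/-- The induced map `G ⊗_R f : G ⊗_R A → G ⊗_R B`, which sends `g ⊗ a` to `g ⊗ f a`. -/
def tensorMap (f : A →ₗ[R] B) : Tensor R G A →+ Tensor R G B :=
  QuotientAddGroup.map _ _ (f.toAddMonoidHom.toIntLinearMap.lTensor G).toAddMonoidHom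
    (balancedRel_le_comap G f)

end Map

/-- The sequence `0 → A → B → C → 0` is exact and remains exact when tensored with any simple
right module. (Every simple right module is isomorphic to one in the universe of `R`.) -/
def IsConeatExact {R : Type u} [Ring R] {A : Type w₁} [AddCommGroup A] [Module R A]
    {B : Type w₂} [AddCommGroup B] [Module R B] {C : Type w₃} [AddCommGroup C] [Module R C]
    (f : A →ₗ[R] B) (g : B →ₗ[R] C) : Prop :=
  (Function.Injective f ∧ Function.Exact f g ∧ Function.Surjective g) ∧
  ∀ (G : Type u) [AddCommGroup G] [Module Rᵐᵒᵖ G], IsSimpleModule Rᵐᵒᵖ G →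
    Function.Injective (tensorMap G f) ∧ Function.Exact (tensorMap G f) (tensorMap G g) ∧
      Function.Surjective (tensorMap G g)

/-- The sequence `0 → A → B` is coneat exact, i.e. `0 → A → B → B / f(A) → 0` is. -/
def IsConeatMono {R : Type u} [Ring R] {A : Type w₁} [AddCommGroup A] [Module R A]
    {B : Type w₂} [AddCommGroup B] [Module R B] (f : A →ₗ[R] B) : Prop :=
  IsConeatExact f (LinearMap.range f).mkQ

/-- `A` is a coneat submodule of `B`. -/
def IsConeatSubmodule {R : Type u} [Ring R] {B : Type w₂} [AddCommGroup B] [Module R B]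
    (A : Submodule R B) : Prop :=
  IsConeatExact A.subtype A.mkQ

/-- `M` is injective with respect to `f : A → B`: every map `A → M` factors through `f`. -/
def IsInjectiveWrt {R : Type u} [Ring R] (M : Type w) [AddCommGroup M] [Module R M]
    {A : Type w₁} [AddCommGroup A] [Module R A] {B : Type w₂} [AddCommGroup B] [Module R B]
    (f : A →ₗ[R] B) : Prop :=
  ∀ h : A →ₗ[R] M, ∃ k : B →ₗ[R] M, k ∘ₗ f = h

/-- The character group `G⁺ = Hom_ℤ(G, ℚ/ℤ)`. For a right module `G` over `R` it is a left module
over `R`, with `(r c)(g) = c(g r)`. -/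
def Character (G : Type w) [AddCommGroup G] : Type w := G →+ AddCircle (1 : ℚ)

noncomputable instance (G : Type w) [AddCommGroup G] : AddCommGroup (Character G) :=
  inferInstanceAs (AddCommGroup (G →+ AddCircle (1 : ℚ)))

noncomputable instance (R : Type u) [Ring R] (G : Type w) [AddCommGroup G] [Module Rᵐᵒᵖ G] :
    Module R (Character G) where
  smul r c :=
    AddMonoidHom.comp (show G →+ AddCircle (1 : ℚ) from c)
      (DistribSMul.toAddMonoidHom G (MulOpposite.op r))
  one_smul c := AddMonoidHom.ext fun g =>
    congrArg (show G →+ AddCircle (1 : ℚ) from c) (one_smul Rᵐᵒᵖ g)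
  mul_smul r s c := AddMonoidHom.ext fun g =>
    congrArg (show G →+ AddCircle (1 : ℚ) from c) (mul_smul (MulOpposite.op s) (MulOpposite.op r) g)
  smul_zero _ := AddMonoidHom.ext fun _ => rfl
  smul_add _ _ _ := AddMonoidHom.ext fun _ => rfl
  add_smul r s c := AddMonoidHom.ext fun g =>
    (congrArg (show G →+ AddCircle (1 : ℚ) from c)
      (add_smul (MulOpposite.op r) (MulOpposite.op s) g)).trans (map_add _ _ _)
  zero_smul c := AddMonoidHom.ext fun g =>
    (congrArg (show G →+ AddCircle (1 : ℚ) from c) (zero_smul Rᵐᵒᵖ g)).trans (map_zero _)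

/-- `M` is isomorphic to a direct summand of `P`. -/
def IsIsoToSummand (R : Type u) [Ring R] (M : Type w₁) [AddCommGroup M] [Module R M]
    (P : Type w₂) [AddCommGroup P] [Module R P] : Prop :=
  ∃ N : Submodule R P, IsComplemented N ∧ Nonempty (M ≃ₗ[R] N)

/-- The class determined by the right modules `R / I`, where `I` is a maximal right ideal or the
zero right ideal: `M` is isomorphic to a direct summand of a product of copies of the character
modules `(R / I)⁺`. Right ideals of `R` are the submodules of `R` over `Rᵐᵒᵖ`. -/
def IsConeatInjective (R : Type u) [Ring R] (M : Type w) [AddCommGroup M] [Module R M] : Prop :=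
  ∃ (ι : Type w) (I : ι → Submodule Rᵐᵒᵖ R), (∀ i, IsCoatom (I i) ∨ I i = ⊥) ∧
    IsIsoToSummand R M ((i : ι) → Character (R ⧸ I i))

/-- `φ : M → E` is an envelope of `M` for the class of coneat injective modules. -/
def IsConeatInjectiveEnvelope {R : Type u} [Ring R] {M E : Type w} [AddCommGroup M] [Module R M]
    [AddCommGroup E] [Module R E] (φ : M →ₗ[R] E) : Prop :=
  IsConeatInjective R E ∧
  (∀ (E' : Type w) [AddCommGroup E'] [Module R E'], IsConeatInjective R E' →
    ∀ ψ : M →ₗ[R] E', ∃ f : E →ₗ[R] E', f ∘ₗ φ = ψ) ∧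
  ∀ f : E →ₗ[R] E, f ∘ₗ φ = φ → Function.Bijective f

end Coneat

/-!
For a right module `G` there is a natural isomorphism `Hom_R(A, G⁺) = Hom_ℤ(G ⊗_R A, ℚ/ℤ)`. As
`ℚ/ℤ` is an injective cogenerator of abelian groups, `G⁺` is injective with respect to
`f : A → B` if and only if `G ⊗_R f` is injective. The tensor product being right exact, and the
case `G = R` being the injectivity of `f` itself, the coneat embeddings are exactly the maps with
respect to which all `(R / I)⁺`, with `I` a maximal right ideal or zero, are injective
(`IsConeatMono.isInjectiveWrt_characterIn`, `isConeatMono_of_isInjectiveWrt_characterIn`). Every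
module `M` has a coneat embedding `charEval` into a product of such modules, so a module which is
injective with respect to coneat embeddings is a direct summand of that product. All of this holds
for characters with values in any divisible group `D` that contains `ℚ/ℤ`.

The existence of envelopes is obtained from `D = ℝ/ℤ`. Then the product `P` into which `M` embeds
is a compact group, and the endomorphisms of `P` under `M` form a compact Hausdorff semigroup `T`
for pointwise convergence, in which right translations are continuous. A minimal left ideal of `T`
is compact, so it contains an idempotent `e`, and by minimality `e T e` is a group
(`exists_minimal_idempotent`). The direct summand `e P` contains the image of `M`, and its monoid of
endomorphisms under `M` is `e T e` (`bijective_of_comp_codRestrict_eq`). Hence `M → e P` is an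
envelope.
-/

namespace Coneat

/-! ### Characters with values in a divisible group -/

/-- The group `Hom_ℤ(G, D)` for an arbitrary group `D` of values; for a right module `G` it is a
left module via `(r c)(g) = c(g r)`. The character module `G⁺` is the case `D = ℚ/ℤ`. -/
def CharacterIn (D : Type) [AddCommGroup D] (G : Type w) [AddCommGroup G] : Type w := G →+ D

namespace CharacterIn

variable {D : Type} [AddCommGroup D] {G : Type w} [AddCommGroup G]

noncomputable instance : AddCommGroup (CharacterIn D G) :=
  inferInstanceAs (AddCommGroup (G →+ D))

instance : FunLike (CharacterIn D G) G D := inferInstanceAs (FunLike (G →+ D) G D)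

instance : AddMonoidHomClass (CharacterIn D G) G D :=
  inferInstanceAs (AddMonoidHomClass (G →+ D) G D)

@[ext] theorem ext {c d : CharacterIn D G} (h : ∀ g, c g = d g) : c = d := DFunLike.ext _ _ h

noncomputable instance {R : Type u} [Ring R] [Module Rᵐᵒᵖ G] : Module R (CharacterIn D G) where
  smul r c := AddMonoidHom.comp (show G →+ D from c)
    (DistribSMul.toAddMonoidHom G (MulOpposite.op r))
  one_smul c := ext fun g => congrArg c (one_smul Rᵐᵒᵖ g)
  mul_smul r s c := ext fun g => congrArg c (mul_smul (MulOpposite.op s) (MulOpposite.op r) g)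
  smul_zero _ := rfl
  smul_add _ _ _ := rfl
  add_smul r s c := ext fun g =>
    (congrArg c (add_smul (MulOpposite.op r) (MulOpposite.op s) g)).trans (map_add _ _ _)
  zero_smul c := ext fun g => (congrArg c (zero_smul Rᵐᵒᵖ g)).trans (map_zero _)

@[simp] theorem smul_apply {R : Type u} [Ring R] [Module Rᵐᵒᵖ G] (r : R) (c : CharacterIn D G)
    (g : G) : (r • c) g = c (MulOpposite.op r • g) := rfl

end CharacterIn

/-- `G⁺` is the module of characters with values in `ℚ/ℤ`. -/
noncomputable def characterEquiv (R : Type u) [Ring R] (G : Type w) [AddCommGroup G]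
    [Module Rᵐᵒᵖ G] : Character G ≃ₗ[R] CharacterIn (AddCircle (1 : ℚ)) G where
  toFun c := c
  invFun c := c
  map_add' _ _ := rfl
  map_smul' _ _ := rfl
  left_inv _ := rfl
  right_inv _ := rfl

/-- An isomorphism of right modules induces an isomorphism of their modules of characters. -/
noncomputable def CharacterIn.congr {R : Type u} [Ring R] (D : Type) [AddCommGroup D]
    {G : Type w} [AddCommGroup G] [Module Rᵐᵒᵖ G] {H : Type w₁} [AddCommGroup H] [Module Rᵐᵒᵖ H]
    (e : G ≃ₗ[Rᵐᵒᵖ] H) : CharacterIn D G ≃ₗ[R] CharacterIn D H where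
  toFun c := AddMonoidHom.comp (show G →+ D from c) e.symm.toAddMonoidHom
  invFun c := AddMonoidHom.comp (show H →+ D from c) e.toAddMonoidHom
  map_add' _ _ := rfl
  map_smul' r c := CharacterIn.ext fun h =>
    congrArg c (map_smul e.symm (MulOpposite.op r) h).symm
  left_inv c := CharacterIn.ext fun g => congrArg c (e.symm_apply_apply g)
  right_inv c := CharacterIn.ext fun h => congrArg c (e.apply_symm_apply h)

/-- An isomorphism of right modules induces an isomorphism of their character modules. -/
noncomputable def characterCongr {R : Type u} [Ring R] {G : Type w} [AddCommGroup G]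
    [Module Rᵐᵒᵖ G] {H : Type w₁} [AddCommGroup H] [Module Rᵐᵒᵖ H] (e : G ≃ₗ[Rᵐᵒᵖ] H) :
    Character G ≃ₗ[R] Character H :=
  (characterEquiv R G).trans ((CharacterIn.congr _ e).trans (characterEquiv R H).symm)

/-- A divisible group is injective. -/
theorem exists_extension_of_divisible (D : Type) [AddCommGroup D] [DivisibleBy D ℤ]
    {A : Type w₁} [AddCommGroup A] {B : Type w₂} [AddCommGroup B] (f : A →+ B)
    (hf : Function.Injective f) (c : A →+ D) : ∃ c' : B →+ D, c'.comp f = c :=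
  (Module.Baer.of_divisible D).extension_property_addMonoidHom f hf c

theorem exists_character_ne_zero {D : Type} [AddCommGroup D] (j : AddCircle (1 : ℚ) →+ D)
    (hj : Function.Injective j) {A : Type w} [AddCommGroup A] {a : A} (ha : a ≠ 0) :
    ∃ c : A →+ D, c a ≠ 0 := by
  obtain ⟨c, hc⟩ := CharacterModule.exists_character_apply_ne_zero_of_ne_zero ha
  refine ⟨j.comp c, fun h => hc (hj ?_)⟩
  rw [map_zero]
  exact h

/-! ### The adjunction between tensor products and characters -/

section Adjunction

variable {R : Type u} [Ring R] {D : Type} [AddCommGroup D] {G : Type w} [AddCommGroup G]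
  [Module Rᵐᵒᵖ G] {A : Type w₁} [AddCommGroup A] [Module R A] {B : Type w₂} [AddCommGroup B]
  [Module R B] {C : Type w₃} [AddCommGroup C] [Module R C]

/-- The class of `g ⊗ a` in `G ⊗_R A`. -/
def Tensor.mk (R : Type u) [Ring R] {G : Type w} [AddCommGroup G] [Module Rᵐᵒᵖ G]
    {A : Type w₁} [AddCommGroup A] [Module R A] (g : G) (a : A) : Tensor R G A :=
  QuotientAddGroup.mk (g ⊗ₜ[ℤ] a)

theorem Tensor.mk_add_left (g g' : G) (a : A) :
    Tensor.mk R (g + g') a = Tensor.mk R g a + Tensor.mk R g' a := by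
  simp only [Tensor.mk, TensorProduct.add_tmul, QuotientAddGroup.mk_add]

theorem Tensor.mk_add_right (g : G) (a a' : A) :
    Tensor.mk R g (a + a') = Tensor.mk R g a + Tensor.mk R g a' := by
  simp only [Tensor.mk, TensorProduct.tmul_add, QuotientAddGroup.mk_add]

theorem Tensor.mk_smul (g : G) (r : R) (a : A) :
    Tensor.mk R g (r • a) = Tensor.mk R (MulOpposite.op r • g) a := by
  refine QuotientAddGroup.eq.2 (AddSubgroup.subset_closure ⟨g, r, a, ?_⟩)
  abel

@[simp] theorem tensorMap_mk (f : A →ₗ[R] B) (g : G) (a : A) :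
    tensorMap G f (Tensor.mk R g a) = Tensor.mk R g (f a) := rfl

theorem Tensor.addHom_ext {s t : Tensor R G A →+ D}
    (h : ∀ g a, s (Tensor.mk R g a) = t (Tensor.mk R g a)) : s = t := by
  refine QuotientAddGroup.addMonoidHom_ext _ (AddMonoidHom.ext fun x => ?_)
  induction x using TensorProduct.induction_on with
  | zero => simp only [map_zero]
  | tmul g a => exact h g a
  | add x y hx hy => rw [map_add, map_add, hx, hy]

/-- The homomorphism `A → Hom_ℤ(G, D)` adjoint to a character `G ⊗_R A → D`. -/
def Tensor.curry (t : Tensor R G A →+ D) : A →ₗ[R] CharacterIn D G where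
  toFun a := AddMonoidHom.mk' (fun g => t (Tensor.mk R g a)) fun g g' => by
    rw [Tensor.mk_add_left, map_add]
  map_add' a a' := CharacterIn.ext fun g => by
    change t _ = t _ + t _
    rw [Tensor.mk_add_right, map_add]
  map_smul' r a := CharacterIn.ext fun g => congrArg t (Tensor.mk_smul g r a)

@[simp] theorem Tensor.curry_apply (t : Tensor R G A →+ D) (a : A) (g : G) :
    Tensor.curry t a g = t (Tensor.mk R g a) := rfl

/-- Every homomorphism `A → Hom_ℤ(G, D)` is adjoint to a character `G ⊗_R A → D`. -/
theorem Tensor.exists_curry_eq (h : A →ₗ[R] CharacterIn D G) :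
    ∃ t : Tensor R G A →+ D, ∀ g a, t (Tensor.mk R g a) = h a g := by
  let b : G →ₗ[ℤ] A →ₗ[ℤ] D := AddMonoidHom.toIntLinearMap <|
    AddMonoidHom.mk' (fun g => AddMonoidHom.toIntLinearMap <|
      AddMonoidHom.mk' (fun a => h a g) fun a a' => by rw [map_add]; rfl) fun g g' => by
        ext a
        exact map_add (h a) g g'
  have hb : balancedRel R G A ≤ (TensorProduct.lift b).toAddMonoidHom.ker := by
    refine (AddSubgroup.closure_le _).2 ?_
    rintro _ ⟨g, r, a, rfl⟩
    rw [SetLike.mem_coe, AddMonoidHom.mem_ker, LinearMap.toAddMonoidHom_coe, map_sub,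
      TensorProduct.lift.tmul, TensorProduct.lift.tmul, sub_eq_zero]
    change h a (MulOpposite.op r • g) = h (r • a) g
    rw [map_smul h]
    rfl
  exact ⟨QuotientAddGroup.lift _ _ hb, fun g a => TensorProduct.lift.tmul g a⟩

theorem isInjectiveWrt_characterIn_of_injective [DivisibleBy D ℤ] {f : A →ₗ[R] B}
    (hf : Function.Injective (tensorMap G f)) : IsInjectiveWrt (CharacterIn D G) f := by
  intro h
  obtain ⟨t, ht⟩ := Tensor.exists_curry_eq h
  obtain ⟨t', ht'⟩ := exists_extension_of_divisible D (tensorMap G f) hf t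
  refine ⟨Tensor.curry t', LinearMap.ext fun a => CharacterIn.ext fun g => ?_⟩
  rw [← ht, ← ht']
  rfl

theorem injective_tensorMap_of_isInjectiveWrt (j : AddCircle (1 : ℚ) →+ D)
    (hj : Function.Injective j) {f : A →ₗ[R] B} (hf : IsInjectiveWrt (CharacterIn D G) f) :
    Function.Injective (tensorMap G f) := by
  rw [injective_iff_map_eq_zero]
  intro x hx
  by_contra hx0
  obtain ⟨t, ht⟩ := exists_character_ne_zero j hj hx0
  obtain ⟨k, hk⟩ := hf (Tensor.curry t)
  obtain ⟨s, hs⟩ := Tensor.exists_curry_eq k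
  have : s.comp (tensorMap G f) = t := Tensor.addHom_ext fun g a => by
    rw [AddMonoidHom.comp_apply, tensorMap_mk, hs, ← LinearMap.comp_apply, hk, Tensor.curry_apply]
  apply ht
  rw [← this, AddMonoidHom.comp_apply, hx, map_zero]

/-- The homomorphism `A → Hom_ℤ(G, D)` adjoint to a character `A → D`, where `G` is isomorphic
to the regular right module, so that `G ⊗_R A = A`. -/
def curryRegular (e : R ≃ₗ[Rᵐᵒᵖ] G) (c : A →+ D) : A →ₗ[R] CharacterIn D G where
  toFun a := AddMonoidHom.mk' (fun g => c (e.symm g • a)) fun g g' => by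
    rw [map_add, add_smul, map_add]
  map_add' a a' := CharacterIn.ext fun g => by
    change c _ = c _ + c _
    rw [smul_add, map_add]
  map_smul' r a := CharacterIn.ext fun g => by
    change c _ = c (e.symm (MulOpposite.op r • g) • a)
    rw [map_smul e.symm, op_smul_eq_mul, mul_smul]

@[simp] theorem curryRegular_apply (e : R ≃ₗ[Rᵐᵒᵖ] G) (c : A →+ D) (a : A) (g : G) :
    curryRegular e c a g = c (e.symm g • a) := rfl

theorem isInjectiveWrt_characterIn_of_equiv [DivisibleBy D ℤ] (e : R ≃ₗ[Rᵐᵒᵖ] G)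
    {f : A →ₗ[R] B} (hf : Function.Injective f) : IsInjectiveWrt (CharacterIn D G) f := by
  intro h
  obtain ⟨c, hc⟩ := exists_extension_of_divisible D f.toAddMonoidHom hf
    (AddMonoidHom.mk' (fun a => h a (e 1)) fun a a' => by rw [map_add]; rfl)
  have hc' (a : A) : c (f a) = h a (e 1) := DFunLike.congr_fun hc a
  refine ⟨curryRegular e c, LinearMap.ext fun a => CharacterIn.ext fun g => ?_⟩
  rw [LinearMap.comp_apply, curryRegular_apply, ← map_smul f, hc', map_smul h,
    CharacterIn.smul_apply, ← map_smul e, op_smul_eq_mul, one_mul, e.apply_symm_apply]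

theorem injective_of_isInjectiveWrt_characterIn (j : AddCircle (1 : ℚ) →+ D)
    (hj : Function.Injective j) (e : R ≃ₗ[Rᵐᵒᵖ] G) {f : A →ₗ[R] B}
    (hf : IsInjectiveWrt (CharacterIn D G) f) : Function.Injective f := by
  rw [injective_iff_map_eq_zero]
  intro a ha
  by_contra ha0
  obtain ⟨c, hc⟩ := exists_character_ne_zero j hj ha0
  obtain ⟨k, hk⟩ := hf (curryRegular e c)
  have h1 := DFunLike.congr_fun (LinearMap.congr_fun hk a) (e 1)
  rw [LinearMap.comp_apply, curryRegular_apply, ha, map_zero, e.symm_apply_apply, one_smul] at h1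
  exact hc h1.symm

/-! ### Right exactness of the tensor product -/

theorem tensorMap_surjective {g : B →ₗ[R] C} (hg : Function.Surjective g) :
    Function.Surjective (tensorMap G g) := by
  intro y
  obtain ⟨y, rfl⟩ := QuotientAddGroup.mk_surjective y
  obtain ⟨x, rfl⟩ := LinearMap.lTensor_surjective G (g := g.toAddMonoidHom.toIntLinearMap) hg y
  exact ⟨QuotientAddGroup.mk x, rfl⟩

theorem tensorMap_exact {f : A →ₗ[R] B} {g : B →ₗ[R] C} (hfg : Function.Exact f g)
    (hg : Function.Surjective g) : Function.Exact (tensorMap G f) (tensorMap G g) := by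
  have hex := lTensor_exact G (f := f.toAddMonoidHom.toIntLinearMap)
    (g := g.toAddMonoidHom.toIntLinearMap) hfg hg
  intro y
  constructor
  · obtain ⟨y, rfl⟩ := QuotientAddGroup.mk_surjective y
    intro hy
    -- The relations of `G ⊗_R C` lift to relations of `G ⊗_R B`, as `g` is surjective.
    have hle : balancedRel R G C ≤ (balancedRel R G B).map
        (g.toAddMonoidHom.toIntLinearMap.lTensor G).toAddMonoidHom := by
      refine (AddSubgroup.closure_le _).2 ?_
      rintro _ ⟨x, r, c, rfl⟩
      obtain ⟨b, rfl⟩ := hg c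
      refine ⟨_, AddSubgroup.subset_closure ⟨x, r, b, rfl⟩, ?_⟩
      simp
    obtain ⟨z, hz, hzy⟩ := hle ((QuotientAddGroup.eq_zero_iff _).1 hy)
    obtain ⟨x, hx⟩ := (hex (y - z)).1 (by
      rw [map_sub, sub_eq_zero]
      exact hzy.symm)
    refine ⟨QuotientAddGroup.mk x, ?_⟩
    change QuotientAddGroup.mk (f.toAddMonoidHom.toIntLinearMap.lTensor G x) = _
    rw [hx, QuotientAddGroup.eq]
    simpa using hz
  · rintro ⟨x, rfl⟩
    obtain ⟨x, rfl⟩ := QuotientAddGroup.mk_surjective x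
    exact congrArg QuotientAddGroup.mk ((hex _).2 ⟨x, rfl⟩)

end Adjunction

/-! ### Retracts and products -/

section Retract

variable {R : Type u} [Ring R] {M : Type w} [AddCommGroup M] [Module R M]
  {P : Type w₁} [AddCommGroup P] [Module R P] {A : Type w₂} [AddCommGroup A] [Module R A]
  {B : Type w₃} [AddCommGroup B] [Module R B]

theorem isIsoToSummand_iff_exists_retraction :
    IsIsoToSummand R M P ↔ ∃ (i : M →ₗ[R] P) (p : P →ₗ[R] M), p ∘ₗ i = LinearMap.id := by
  constructor
  · rintro ⟨N, ⟨N', hN⟩, ⟨e⟩⟩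
    refine ⟨N.subtype ∘ₗ e.toLinearMap, e.symm.toLinearMap ∘ₗ N.projectionOnto N' hN, ?_⟩
    ext m
    simp
  · rintro ⟨i, p, hip⟩
    have hpi (m : M) : p (i m) = m := LinearMap.congr_fun hip m
    refine ⟨LinearMap.range i, ⟨_, LinearMap.isCompl_of_proj (f := i.rangeRestrict ∘ₗ p) ?_⟩,
      ⟨LinearEquiv.ofInjective i (Function.LeftInverse.injective hpi)⟩⟩
    rintro ⟨_, m, rfl⟩
    exact Subtype.ext (congrArg i (hpi m))

theorem IsInjectiveWrt.of_retraction {f : A →ₗ[R] B} (hf : IsInjectiveWrt P f) (i : M →ₗ[R] P)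
    (p : P →ₗ[R] M) (hip : p ∘ₗ i = LinearMap.id) : IsInjectiveWrt M f := by
  intro h
  obtain ⟨k, hk⟩ := hf (i ∘ₗ h)
  refine ⟨p ∘ₗ k, ?_⟩
  rw [LinearMap.comp_assoc, hk, ← LinearMap.comp_assoc, hip, LinearMap.id_comp]

theorem IsInjectiveWrt.of_equiv {f : A →ₗ[R] B} (hf : IsInjectiveWrt P f) (e : M ≃ₗ[R] P) :
    IsInjectiveWrt M f :=
  hf.of_retraction e.toLinearMap e.symm.toLinearMap e.symm_comp

theorem IsInjectiveWrt.pi {ι : Type w} {N : ι → Type w₁} [∀ i, AddCommGroup (N i)]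
    [∀ i, Module R (N i)] {f : A →ₗ[R] B} (hf : ∀ i, IsInjectiveWrt (N i) f) :
    IsInjectiveWrt ((i : ι) → N i) f := by
  intro h
  choose k hk using fun i => hf i (LinearMap.proj i ∘ₗ h)
  refine ⟨LinearMap.pi k, LinearMap.ext fun a => funext fun i => LinearMap.congr_fun (hk i) a⟩

end Retract

/-! ### Coneat embeddings -/

section Embedding

variable {R : Type u} [Ring R] {A : Type w₁} [AddCommGroup A] [Module R A]
  {B : Type w₂} [AddCommGroup B] [Module R B]

/-- The tensor product being right exact, only the injectivity statements in the definition of a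
coneat exact sequence `0 → A → B` carry information. -/
theorem isConeatMono_iff (f : A →ₗ[R] B) :
    IsConeatMono f ↔ Function.Injective f ∧
      ∀ (G : Type u) [AddCommGroup G] [Module Rᵐᵒᵖ G], IsSimpleModule Rᵐᵒᵖ G →
        Function.Injective (tensorMap G f) := by
  constructor
  · rintro ⟨⟨hf, -⟩, h⟩
    exact ⟨hf, fun G _ _ hG => (h G hG).1⟩
  · rintro ⟨hf, h⟩
    have hex : Function.Exact f (LinearMap.range f).mkQ := fun b => by simp
    have hsurj := (LinearMap.range f).mkQ_surjective
    exact ⟨⟨hf, hex, hsurj⟩, fun G _ _ hG =>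
      ⟨h G hG, tensorMap_exact hex hsurj, tensorMap_surjective hsurj⟩⟩

theorem IsConeatExact.isConeatMono {C : Type w₃} [AddCommGroup C] [Module R C] {f : A →ₗ[R] B}
    {g : B →ₗ[R] C} (h : IsConeatExact f g) : IsConeatMono f :=
  (isConeatMono_iff f).2 ⟨h.1.1, fun G _ _ hG => (h.2 G hG).1⟩

/-- A maximal right ideal of `R` or the zero right ideal. -/
abbrev TestIdeal (R : Type u) [Ring R] : Type u :=
  {I : Submodule Rᵐᵒᵖ R // IsCoatom I ∨ I = ⊥}

/-- The zero right ideal, for which `R / I` is the regular right module. -/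
def TestIdeal.bot (R : Type u) [Ring R] : TestIdeal R := ⟨⊥, Or.inr rfl⟩

/-- A simple right module is `R / I` for the annihilator `I` of a nonzero element, which is a maximal
right ideal; the regular module is `R / 0`. -/
theorem exists_testIdeal_equiv (G : Type u) [AddCommGroup G] [Module Rᵐᵒᵖ G]
    (hG : IsSimpleModule Rᵐᵒᵖ G ∨ Nonempty (G ≃ₗ[Rᵐᵒᵖ] R)) :
    ∃ I : TestIdeal R, Nonempty ((R ⧸ I.1) ≃ₗ[Rᵐᵒᵖ] G) := by
  obtain hG | ⟨⟨e⟩⟩ := hG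
  · have := IsSimpleModule.nontrivial Rᵐᵒᵖ G
    obtain ⟨g, hg⟩ := exists_ne (0 : G)
    let q : R →ₗ[Rᵐᵒᵖ] G :=
      { toFun := fun r => MulOpposite.op r • g
        map_add' := fun r s => by rw [MulOpposite.op_add, add_smul]
        map_smul' := fun r s => mul_smul r (MulOpposite.op s) g }
    have hq : q ≠ 0 := fun h => hg (by simpa [q] using LinearMap.congr_fun h 1)
    let e := q.quotKerEquivOfSurjective (LinearMap.surjective_of_ne_zero hq)
    exact ⟨⟨LinearMap.ker q, Or.inl (isSimpleModule_iff_isCoatom.1 (IsSimpleModule.congr e))⟩, ⟨e⟩⟩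
  · exact ⟨TestIdeal.bot R, ⟨(Submodule.quotEquivOfEqBot _ rfl).trans e.symm⟩⟩

variable {D : Type} [AddCommGroup D]

/-- The modules `Hom_ℤ(R / I, D)` are injective with respect to coneat embeddings if `D` is
divisible. -/
theorem IsConeatMono.isInjectiveWrt_characterIn [DivisibleBy D ℤ] {f : A →ₗ[R] B}
    (hf : IsConeatMono f) (I : TestIdeal R) : IsInjectiveWrt (CharacterIn D (R ⧸ I.1)) f := by
  obtain ⟨h0, h⟩ := (isConeatMono_iff f).1 hf
  obtain hI | hI := I.2
  · exact isInjectiveWrt_characterIn_of_injective (h _ (isSimpleModule_iff_isCoatom.2 hI))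
  · exact isInjectiveWrt_characterIn_of_equiv (Submodule.quotEquivOfEqBot _ hI).symm h0

/-- Conversely, the modules `Hom_ℤ(R / I, D)` detect coneat embeddings if `D` contains `ℚ/ℤ`. -/
theorem isConeatMono_of_isInjectiveWrt_characterIn (j : AddCircle (1 : ℚ) →+ D)
    (hj : Function.Injective j) {f : A →ₗ[R] B}
    (hf : ∀ I : TestIdeal R, IsInjectiveWrt (CharacterIn D (R ⧸ I.1)) f) : IsConeatMono f := by
  refine (isConeatMono_iff f).2 ⟨injective_of_isInjectiveWrt_characterIn j hj
    (Submodule.quotEquivOfEqBot _ rfl).symm (hf (TestIdeal.bot R)), fun G _ _ hG => ?_⟩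
  obtain ⟨I, ⟨e⟩⟩ := exists_testIdeal_equiv G (Or.inl hG)
  exact injective_tensorMap_of_isInjectiveWrt j hj ((hf I).of_equiv (CharacterIn.congr D e.symm))

theorem IsConeatInjective.isInjectiveWrt {M : Type w} [AddCommGroup M] [Module R M]
    (hM : IsConeatInjective R M) {f : A →ₗ[R] B} (hf : IsConeatMono f) : IsInjectiveWrt M f := by
  obtain ⟨ι, I, hI, hP⟩ := hM
  obtain ⟨i, p, hip⟩ := isIsoToSummand_iff_exists_retraction.1 hP
  exact (IsInjectiveWrt.pi fun x => (hf.isInjectiveWrt_characterIn ⟨I x, hI x⟩).of_equiv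
    (characterEquiv R _)).of_retraction i p hip

end Embedding

/-! ### Enough coneat injective modules -/

section Enough

variable {R : Type u} [Ring R]

/-- The product of the modules `Hom_ℤ(R / I, D)`, where `I` is a maximal right ideal or zero, with
one factor for each homomorphism from `M` to such a module. -/
abbrev CharProd (R : Type u) [Ring R] (D : Type) [AddCommGroup D] (M : Type w) [AddCommGroup M]
    [Module R M] : Type (max u w) :=
  (x : Σ I : TestIdeal R, M →ₗ[R] CharacterIn D (R ⧸ I.1)) → CharacterIn D (R ⧸ x.1.1)

/-- The canonical homomorphism, through which every `M → Hom_ℤ(R / I, D)` factors. -/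
noncomputable def charEval (R : Type u) [Ring R] (D : Type) [AddCommGroup D] (M : Type w)
    [AddCommGroup M] [Module R M] : M →ₗ[R] CharProd R D M :=
  LinearMap.pi fun x => x.2

variable {D : Type} [AddCommGroup D] {M : Type w} [AddCommGroup M] [Module R M]

theorem charEval_apply (m : M) (x : Σ I : TestIdeal R, M →ₗ[R] CharacterIn D (R ⧸ I.1)) :
    charEval R D M m x = x.2 m := rfl

theorem isConeatMono_charEval (j : AddCircle (1 : ℚ) →+ D) (hj : Function.Injective j) :
    IsConeatMono (charEval R D M) :=
  isConeatMono_of_isInjectiveWrt_characterIn j hj fun I h => by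
    refine ⟨LinearMap.proj (φ := fun x : Σ I : TestIdeal R, M →ₗ[R] CharacterIn D (R ⧸ I.1) =>
      CharacterIn D (R ⧸ x.1.1)) ⟨I, h⟩, ?_⟩
    exact LinearMap.ext fun m => charEval_apply m ⟨I, h⟩

theorem IsConeatMono.isInjectiveWrt_charProd [DivisibleBy D ℤ] {A : Type w₁} [AddCommGroup A]
    [Module R A] {B : Type w₂} [AddCommGroup B] [Module R B] {f : A →ₗ[R] B}
    (hf : IsConeatMono f) : IsInjectiveWrt (CharProd R D M) f :=
  IsInjectiveWrt.pi fun x => hf.isInjectiveWrt_characterIn x.1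

theorem isConeatInjective_of_retraction {ι : Type w} (I : ι → TestIdeal R) {N : ι → Type w₁}
    [∀ x, AddCommGroup (N x)] [∀ x, Module R (N x)] (e : ∀ x, N x ≃ₗ[R] Character (R ⧸ (I x).1))
    (i : M →ₗ[R] ((x : ι) → N x)) (p : ((x : ι) → N x) →ₗ[R] M) (hip : p ∘ₗ i = LinearMap.id) :
    IsConeatInjective R M := by
  let E : ((x : ι) → N x) ≃ₗ[R] ((x : ι) → Character (R ⧸ (I x).1)) := LinearEquiv.piCongrRight e
  refine ⟨ι, fun x => (I x).1, fun x => (I x).2, isIsoToSummand_iff_exists_retraction.2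
    ⟨E.toLinearMap ∘ₗ i, p ∘ₗ E.symm.toLinearMap, LinearMap.ext fun m => ?_⟩⟩
  change p (E.symm (E (i m))) = m
  rw [E.symm_apply_apply]
  exact LinearMap.congr_fun hip m

/-- A module that is injective with respect to its embedding in a product of character modules is
a direct summand of that product. -/
theorem isConeatInjective_of_isInjectiveWrt_charEval {M : Type (max u v)} [AddCommGroup M]
    [Module R M] (hM : IsInjectiveWrt M (charEval R (AddCircle (1 : ℚ)) M)) :
    IsConeatInjective R M := by
  obtain ⟨k, hk⟩ := hM LinearMap.id
  exact isConeatInjective_of_retraction _ (fun _ => (characterEquiv R _).symm) _ k hk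

/-- The power over a one-point type lifts `(R / I)⁺` to the universe of the modules under
consideration. -/
theorem isConeatInjective_character (I : TestIdeal R) :
    IsConeatInjective R (PUnit.{max u v + 1} → Character (R ⧸ I.1)) :=
  ⟨PUnit, fun _ => I.1, fun _ => I.2,
    isIsoToSummand_iff_exists_retraction.2 ⟨LinearMap.id, LinearMap.id, rfl⟩⟩

/-- A map is a coneat embedding as soon as the coneat injective modules in one universe above that
of `R` are injective with respect to it. -/
theorem isConeatMono_iff_forall_isInjectiveWrt {A : Type w₁} [AddCommGroup A] [Module R A]
    {B : Type w₂} [AddCommGroup B] [Module R B] (f : A →ₗ[R] B) :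
    IsConeatMono f ↔ ∀ (M : Type (max u v)) [AddCommGroup M] [Module R M],
      IsConeatInjective R M → IsInjectiveWrt M f := by
  refine ⟨fun hf M _ _ hM => hM.isInjectiveWrt hf, fun h =>
    isConeatMono_of_isInjectiveWrt_characterIn (AddMonoidHom.id _) Function.injective_id
      fun I => ?_⟩
  exact (h _ (isConeatInjective_character.{u, v} I)).of_retraction
    (LinearMap.pi fun _ => (characterEquiv R _).symm.toLinearMap)
    ((characterEquiv R _).toLinearMap ∘ₗ LinearMap.proj PUnit.unit) rfl

end Enough

/-! ### Minimal idempotents of compact semigroups -/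

/-- A compact Hausdorff semigroup `T` with continuous right translations has an idempotent `e` such
that every element of `e T e` is left invertible in `T` relative to `e`. Such an `e` is found in a
minimal left ideal. -/
theorem exists_minimal_idempotent {T : Type w} [Nonempty T] [Semigroup T] [TopologicalSpace T]
    [CompactSpace T] [T2Space T] (hT : ∀ t : T, Continuous (· * t)) :
    ∃ e : T, e * e = e ∧ ∀ x, ∃ y, y * (e * x * e) = e := by
  obtain ⟨L, hL⟩ : ∃ L, Minimal
      (· ∈ {N : Set T | IsClosed N ∧ N.Nonempty ∧ ∀ t, ∀ x ∈ N, t * x ∈ N}) L := by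
    refine zorn_superset _ fun c hcs hc => ?_
    refine ⟨⋂₀ c, ⟨isClosed_sInter fun t ht => (hcs ht).1, ?_, fun t x hx s hs =>
      (hcs hs).2.2 t x (hx s hs)⟩, fun s hs => Set.sInter_subset_of_mem hs⟩
    obtain rfl | hne := c.eq_empty_or_nonempty
    · rw [Set.sInter_empty]
      exact Set.univ_nonempty
    · have := hne.to_subtype
      exact IsCompact.nonempty_sInter_of_directed_nonempty_isCompact_isClosed
        (IsChain.directedOn hc.symm) (fun s hs => (hcs hs).2.1) (fun s hs => (hcs hs).1.isCompact)
        fun s hs => (hcs hs).1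
  obtain ⟨hLc, hLn, hLT⟩ := hL.prop
  have hmin {x : T} (hx : x ∈ L) : Set.range (· * x) = L := by
    refine hL.eq_of_subset ⟨?_, Set.range_nonempty _, ?_⟩ ?_
    · rw [← Set.image_univ]
      exact (hT x).isClosedMap _ isClosed_univ
    · rintro t _ ⟨s, rfl⟩
      exact ⟨t * s, mul_assoc _ _ _⟩
    · rintro _ ⟨s, rfl⟩
      exact hLT s x hx
  obtain ⟨e, he, hee⟩ := exists_idempotent_in_compact_subsemigroup hT L hLn hLc.isCompact
    fun x _ y hy => hLT x y hy
  refine ⟨e, hee, fun x => ?_⟩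
  have : e ∈ Set.range (· * (e * x * e)) := by
    rw [hmin (hLT _ _ he)]
    exact he
  exact this

/-! ### Endomorphisms of products of circle-valued characters -/

theorem exists_injective_ratCircle_to_realCircle :
    ∃ j : AddCircle (1 : ℚ) →+ AddCircle (1 : ℝ), Function.Injective j := by
  let c : ℚ →+ ℝ := (Rat.castHom ℝ).toAddMonoidHom
  have hc (x : ℚ) : x ∈ AddSubgroup.zmultiples (1 : ℚ) ↔
      c x ∈ AddSubgroup.zmultiples (1 : ℝ) := by
    simp only [AddSubgroup.mem_zmultiples_iff, zsmul_one]
    refine exists_congr fun n => ?_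
    change _ ↔ (n : ℝ) = (x : ℝ)
    norm_cast
  refine ⟨QuotientAddGroup.map _ _ c fun x hx => (hc x).1 hx, ?_⟩
  rw [injective_iff_map_eq_zero]
  intro x hx
  obtain ⟨x, rfl⟩ := QuotientAddGroup.mk_surjective x
  exact (QuotientAddGroup.eq_zero_iff _).2 ((hc x).2 ((QuotientAddGroup.eq_zero_iff _).1 hx))

section Compact

variable {R : Type u} [Ring R] {ι : Type w} {G : ι → Type w₁} [∀ i, AddCommGroup (G i)]
  [∀ i, Module Rᵐᵒᵖ (G i)] {M : Type w₂} [AddCommGroup M] [Module R M]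

/-- The endomorphisms of a product of modules of circle-valued characters that fix `φ`. -/
abbrev FixingEnd (φ : M →ₗ[R] ((i : ι) → CharacterIn (AddCircle (1 : ℝ)) (G i))) : Type _ :=
  {f : Module.End R ((i : ι) → CharacterIn (AddCircle (1 : ℝ)) (G i)) // f ∘ₗ φ = φ}

namespace FixingEnd

variable (φ : M →ₗ[R] ((i : ι) → CharacterIn (AddCircle (1 : ℝ)) (G i)))

noncomputable instance : Semigroup (FixingEnd φ) where
  mul f g := ⟨f.1 * g.1, LinearMap.ext fun m => by
    have hf := LinearMap.congr_fun f.2 m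
    have hg := LinearMap.congr_fun g.2 m
    simp only [LinearMap.comp_apply] at hf hg
    rw [LinearMap.comp_apply, Module.End.mul_apply, hg, hf]⟩
  mul_assoc f g h := rfl

instance : Nonempty (FixingEnd φ) := ⟨⟨LinearMap.id, rfl⟩⟩

/-- The values `f(p)_i(g)` in the circle of an endomorphism `f`. -/
noncomputable def values (f : FixingEnd φ) :
    (((i : ι) → CharacterIn (AddCircle (1 : ℝ)) (G i)) × Σ i, G i) → AddCircle (1 : ℝ) :=
  fun x => f.1 x.1 x.2.1 x.2.2

/-- The topology of pointwise convergence of the values. -/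
noncomputable instance : TopologicalSpace (FixingEnd φ) := .induced (values φ) inferInstance

theorem values_injective : Function.Injective (values φ) := fun _ _ h =>
  Subtype.ext <| LinearMap.ext fun p => funext fun i => CharacterIn.ext fun g =>
    congrFun h (p, ⟨i, g⟩)

/-- Every condition on the right-hand side is closed for pointwise convergence, so `FixingEnd φ`
is a closed subspace of a power of the circle. -/
theorem range_values : Set.range (values φ) =
    {F | (∀ p i g g', F (p, ⟨i, g + g'⟩) = F (p, ⟨i, g⟩) + F (p, ⟨i, g'⟩)) ∧
      (∀ p p' i g, F (p + p', ⟨i, g⟩) = F (p, ⟨i, g⟩) + F (p', ⟨i, g⟩)) ∧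
      (∀ (r : R) p i g, F (r • p, ⟨i, g⟩) = F (p, ⟨i, MulOpposite.op r • g⟩)) ∧
      ∀ m i g, F (φ m, ⟨i, g⟩) = φ m i g} := by
  ext F
  constructor
  · rintro ⟨f, rfl⟩
    refine ⟨fun p i g g' => map_add (f.1 p i) g g', fun p p' i g => ?_, fun r p i g => ?_,
      fun m i g => ?_⟩
    · change f.1 (p + p') i g = _
      rw [map_add]
      rfl
    · change f.1 (r • p) i g = _
      rw [map_smul]
      rfl
    · exact DFunLike.congr_fun (congrFun (LinearMap.congr_fun f.2 m) i) g
  · rintro ⟨h1, h2, h3, h4⟩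
    exact ⟨⟨{ toFun := fun p i => AddMonoidHom.mk' (fun g => F (p, ⟨i, g⟩)) (h1 p i)
              map_add' := fun p p' => funext fun i => CharacterIn.ext fun g => h2 p p' i g
              map_smul' := fun r p => funext fun i => CharacterIn.ext fun g => h3 r p i g },
      LinearMap.ext fun m => funext fun i => CharacterIn.ext fun g => h4 m i g⟩, rfl⟩

theorem isClosedEmbedding_values : Topology.IsClosedEmbedding (values φ) := by
  refine ⟨⟨⟨rfl⟩, values_injective φ⟩, ?_⟩
  rw [range_values]
  simp only [Set.ofPred_and, Set.ofPred_forall]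
  refine IsClosed.inter ?_ (IsClosed.inter ?_ (IsClosed.inter ?_ ?_))
  all_goals
    repeat' refine isClosed_iInter fun _ => ?_
    exact isClosed_eq (by fun_prop) (by fun_prop)

instance : CompactSpace (FixingEnd φ) :=
  have : Fact ((0 : ℝ) < 1) := ⟨one_pos⟩
  (isClosedEmbedding_values φ).compactSpace

instance : T2Space (FixingEnd φ) := (isClosedEmbedding_values φ).isEmbedding.t2Space

theorem continuous_mul_right (g : FixingEnd φ) : Continuous (· * g) := by
  refine continuous_induced_rng.2 (continuous_pi fun x => ?_)
  have h : Continuous (values φ) := continuous_induced_dom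
  exact continuous_pi_iff.1 h (g.1 x.1, x.2)

end FixingEnd

end Compact

/-! ### Characterizations of coneat injectivity; envelopes -/

section Envelope

variable {R : Type u} [Ring R]

theorem isConeatInjective_iff_forall_isInjectiveWrt (M : Type (max u v)) [AddCommGroup M]
    [Module R M] :
    IsConeatInjective R M ↔
      ∀ (A B C : Type (max u v)) [AddCommGroup A] [AddCommGroup B] [AddCommGroup C]
        [Module R A] [Module R B] [Module R C] (f : A →ₗ[R] B) (g : B →ₗ[R] C),
        IsConeatExact f g → IsInjectiveWrt M f :=
  ⟨fun hM _ _ _ _ _ _ _ _ _ _ _ hfg => hM.isInjectiveWrt hfg.isConeatMono,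
    fun h => isConeatInjective_of_isInjectiveWrt_charEval.{u, v} <|
      h _ _ _ _ _ (isConeatMono_charEval (AddMonoidHom.id _) Function.injective_id)⟩

theorem isConeatInjective_iff_exists_simple_or_regular (M : Type (max u v)) [AddCommGroup M]
    [Module R M] :
    IsConeatInjective R M ↔
      ∃ (ι : Type (max u v)) (G : ι → Type u) (_ : ∀ i, AddCommGroup (G i))
        (_ : ∀ i, Module Rᵐᵒᵖ (G i)),
        (∀ i, IsSimpleModule Rᵐᵒᵖ (G i) ∨ Nonempty (G i ≃ₗ[Rᵐᵒᵖ] R)) ∧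
        IsIsoToSummand R M ((i : ι) → Character (G i)) := by
  constructor
  · rintro ⟨ι, I, hI, hM⟩
    exact ⟨ι, fun i => R ⧸ I i, fun _ => inferInstance, fun _ => inferInstance,
      fun i => (hI i).imp isSimpleModule_iff_isCoatom.2
        fun h => ⟨Submodule.quotEquivOfEqBot _ h⟩, hM⟩
  · rintro ⟨ι, G, _, _, hG, hM⟩
    choose I e using fun i => exists_testIdeal_equiv (G i) (hG i)
    obtain ⟨i, p, hip⟩ := isIsoToSummand_iff_exists_retraction.1 hM
    exact isConeatInjective_of_retraction I (fun x => (characterCongr (e x).some).symm) i p hip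

/-- If `e` is an idempotent in the monoid `T` of endomorphisms of `P` under `M` such that every
element of `e T e` is left invertible relative to `e`, then `e T e` is a group; it is the monoid of
endomorphisms of `e P` under `M`. -/
theorem bijective_of_comp_codRestrict_eq {M : Type w₁} [AddCommGroup M] [Module R M]
    {P : Type w₂} [AddCommGroup P] [Module R P] {φ : M →ₗ[R] P} {e : P →ₗ[R] P}
    (heφ : ∀ m, e (φ m) = φ m) (hee : e ∘ₗ e = e)
    (he : ∀ f : P →ₗ[R] P, f ∘ₗ φ = φ → ∃ y : P →ₗ[R] P, y ∘ₗ φ = φ ∧ y ∘ₗ (e ∘ₗ f ∘ₗ e) = e) :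
    ∀ f : LinearMap.range e →ₗ[R] LinearMap.range e,
      f ∘ₗ φ.codRestrict (LinearMap.range e) (fun m => ⟨φ m, heφ m⟩) =
        φ.codRestrict (LinearMap.range e) (fun m => ⟨φ m, heφ m⟩) → Function.Bijective f := by
  set E := LinearMap.range e
  set ψ : M →ₗ[R] E := φ.codRestrict E fun m => ⟨φ m, heφ m⟩
  have heE (x : E) : e x = x := by
    obtain ⟨_, y, rfl⟩ := x
    exact LinearMap.congr_fun hee y
  have hr (x : E) : e.rangeRestrict x.1 = x := Subtype.ext (heE x)
  have hrψ (m : M) : e.rangeRestrict (φ m) = ψ m := Subtype.ext (heφ m)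
  have hleft (f : E →ₗ[R] E) (hf : f ∘ₗ ψ = ψ) :
      ∃ g : E →ₗ[R] E, g ∘ₗ ψ = ψ ∧ g ∘ₗ f = LinearMap.id := by
    have hfψ (m : M) : f (ψ m) = ψ m := LinearMap.congr_fun hf m
    obtain ⟨y, hyφ, hy⟩ := he (E.subtype ∘ₗ f ∘ₗ e.rangeRestrict) <| LinearMap.ext fun m => by
      change (f (e.rangeRestrict (φ m)) : P) = φ m
      rw [hrψ, hfψ]
      rfl
    refine ⟨e.rangeRestrict ∘ₗ y ∘ₗ E.subtype, LinearMap.ext fun m => ?_,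
      LinearMap.ext fun x => Subtype.ext ?_⟩
    · change e.rangeRestrict (y (φ m)) = ψ m
      rw [show y (φ m) = φ m from LinearMap.congr_fun hyφ m, hrψ]
    · have h := LinearMap.congr_fun hy x.1
      change y (e (f (e.rangeRestrict (e x))).1) = e x at h
      rw [heE, heE, hr] at h
      change e (y (f x)) = x
      rw [h, heE]
  intro f hf
  -- In a monoid in which every element has a left inverse, left inverses are two-sided.
  obtain ⟨g, hg, hgf⟩ := hleft f hf
  obtain ⟨h, -, hhg⟩ := hleft g hg
  have hfh : f = h := by
    rw [← LinearMap.id_comp f, ← hhg, LinearMap.comp_assoc, hgf, LinearMap.comp_id]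
  rw [← hfh] at hhg
  exact Function.bijective_iff_has_inverse.2
    ⟨g, LinearMap.congr_fun hgf, LinearMap.congr_fun hhg⟩

theorem exists_idempotent_forall_bijective {M : Type w₁} [AddCommGroup M] [Module R M]
    {ι : Type w₂} {G : ι → Type w₃} [∀ i, AddCommGroup (G i)] [∀ i, Module Rᵐᵒᵖ (G i)]
    (φ : M →ₗ[R] ((i : ι) → CharacterIn (AddCircle (1 : ℝ)) (G i))) :
    ∃ (e : Module.End R ((i : ι) → CharacterIn (AddCircle (1 : ℝ)) (G i)))
      (heφ : ∀ m, e (φ m) = φ m), e ∘ₗ e = e ∧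
      ∀ f : LinearMap.range e →ₗ[R] LinearMap.range e,
        f ∘ₗ φ.codRestrict (LinearMap.range e) (fun m => ⟨φ m, heφ m⟩) =
          φ.codRestrict (LinearMap.range e) (fun m => ⟨φ m, heφ m⟩) → Function.Bijective f := by
  obtain ⟨e, hee, he⟩ := exists_minimal_idempotent (FixingEnd.continuous_mul_right φ)
  have hee' : e.1 ∘ₗ e.1 = e.1 := congrArg Subtype.val hee
  have heφ (m : M) : e.1 (φ m) = φ m := LinearMap.congr_fun e.2 m
  refine ⟨e.1, heφ, hee', bijective_of_comp_codRestrict_eq heφ hee' fun f hf => ?_⟩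
  obtain ⟨y, hy⟩ := he ⟨f, hf⟩
  exact ⟨y.1, y.2, congrArg Subtype.val hy⟩

/-- The image of a minimal idempotent in the compact semigroup of endomorphisms under `M` of a
product of circle-valued characters is an envelope of `M`. -/
theorem exists_isConeatInjectiveEnvelope (M : Type (max u v)) [AddCommGroup M] [Module R M] :
    ∃ (E : Type (max u v)) (_ : AddCommGroup E) (_ : Module R E) (φ : M →ₗ[R] E),
      IsConeatInjectiveEnvelope φ := by
  obtain ⟨j, hj⟩ := exists_injective_ratCircle_to_realCircle
  have hφ : IsConeatMono (charEval R (AddCircle (1 : ℝ)) M) := isConeatMono_charEval j hj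
  obtain ⟨e, heφ, hee, he⟩ :=
    exists_idempotent_forall_bijective (charEval R (AddCircle (1 : ℝ)) M)
  refine ⟨LinearMap.range e, inferInstance, inferInstance,
    (charEval R (AddCircle (1 : ℝ)) M).codRestrict (LinearMap.range e) fun m => ⟨_, heφ m⟩,
    ?_, fun E' _ _ hE' χ => ?_, he⟩
  · refine isConeatInjective_of_isInjectiveWrt_charEval.{u, v} ?_
    refine (IsConeatMono.isInjectiveWrt_charProd (D := AddCircle (1 : ℝ)) (M := M)
      (isConeatMono_charEval (AddMonoidHom.id _) Function.injective_id)).of_retraction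
        (LinearMap.range e).subtype e.rangeRestrict ?_
    refine LinearMap.ext ?_
    rintro ⟨_, y, rfl⟩
    exact Subtype.ext (LinearMap.congr_fun hee y)
  · obtain ⟨k, hk⟩ := hE'.isInjectiveWrt hφ χ
    exact ⟨k ∘ₗ (LinearMap.range e).subtype, hk⟩

variable {M E E' : Type w} [AddCommGroup M] [AddCommGroup E] [AddCommGroup E'] [Module R M]
  [Module R E] [Module R E']

theorem IsConeatInjectiveEnvelope.exists_equiv {φ : M →ₗ[R] E} {φ' : M →ₗ[R] E'}
    (h : IsConeatInjectiveEnvelope φ) (h' : IsConeatInjectiveEnvelope φ') :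
    ∃ e : E ≃ₗ[R] E', e.toLinearMap ∘ₗ φ = φ' := by
  obtain ⟨f, hf⟩ := h.2.1 E' h'.1 φ'
  obtain ⟨g, hg⟩ := h'.2.1 E h.1 φ
  have hgf : Function.Bijective (g ∘ f) := h.2.2 (g ∘ₗ f) (by rw [LinearMap.comp_assoc, hf, hg])
  have hfg : Function.Bijective (f ∘ g) := h'.2.2 (f ∘ₗ g) (by rw [LinearMap.comp_assoc, hg, hf])
  exact ⟨LinearEquiv.ofBijective f ⟨hgf.1.of_comp, hfg.2.of_comp⟩, hf⟩

theorem IsConeatInjectiveEnvelope.injective_and_isConeatSubmodule {M E : Type (max u v)}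
    [AddCommGroup M] [AddCommGroup E] [Module R M] [Module R E] {φ : M →ₗ[R] E}
    (h : IsConeatInjectiveEnvelope φ) :
    Function.Injective φ ∧ IsConeatSubmodule (LinearMap.range φ) := by
  refine ⟨((isConeatMono_iff_forall_isInjectiveWrt.{u, v} φ).2
    fun N _ _ hN χ => h.2.1 N hN χ).1.1, ?_⟩
  have hr : IsConeatMono (LinearMap.range φ).subtype := by
    refine (isConeatMono_iff_forall_isInjectiveWrt.{u, v} _).2 fun N _ _ hN χ => ?_
    obtain ⟨k, hk⟩ := h.2.1 N hN (χ ∘ₗ φ.rangeRestrict)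
    refine ⟨k, LinearMap.ext ?_⟩
    rintro ⟨_, m, rfl⟩
    exact LinearMap.congr_fun hk m
  unfold IsConeatMono at hr
  unfold IsConeatSubmodule
  rwa [Submodule.range_subtype] at hr

end Envelope

end Coneat

theorem mainTheorem1 (R : Type u) [Ring R] :
    -- description of the coneat injective modules
    (∀ (M : Type (max u v)) [AddCommGroup M] [Module R M],
      Coneat.IsConeatInjective R M ↔
        ∃ (ι : Type (max u v)) (G : ι → Type u) (_ : ∀ i, AddCommGroup (G i))
          (_ : ∀ i, Module Rᵐᵒᵖ (G i)),
          (∀ i, IsSimpleModule Rᵐᵒᵖ (G i) ∨ Nonempty (G i ≃ₗ[Rᵐᵒᵖ] R)) ∧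
          Coneat.IsIsoToSummand R M ((i : ι) → Coneat.Character (G i))) ∧
    -- (1)
    (∀ (M : Type (max u v)) [AddCommGroup M] [Module R M],
      Coneat.IsConeatInjective R M ↔
        ∀ (A B C : Type (max u v)) [AddCommGroup A] [AddCommGroup B] [AddCommGroup C]
          [Module R A] [Module R B] [Module R C] (f : A →ₗ[R] B) (g : B →ₗ[R] C),
          Coneat.IsConeatExact f g → Coneat.IsInjectiveWrt M f) ∧
    -- (2)
    (∀ (A B : Type (max u v)) [AddCommGroup A] [AddCommGroup B] [Module R A] [Module R B]
      (f : A →ₗ[R] B),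
      Coneat.IsConeatMono f ↔
        ∀ (M : Type (max u v)) [AddCommGroup M] [Module R M],
          Coneat.IsConeatInjective R M → Coneat.IsInjectiveWrt M f) ∧
    -- (3)
    (∀ (M : Type (max u v)) [AddCommGroup M] [Module R M],
      (∃ (E : Type (max u v)) (_ : AddCommGroup E) (_ : Module R E) (φ : M →ₗ[R] E),
        Coneat.IsConeatInjectiveEnvelope φ) ∧
      (∀ (E E' : Type (max u v)) [AddCommGroup E] [AddCommGroup E'] [Module R E] [Module R E']
        (φ : M →ₗ[R] E) (φ' : M →ₗ[R] E'),
        Coneat.IsConeatInjectiveEnvelope φ → Coneat.IsConeatInjectiveEnvelope φ' →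
          ∃ e : E ≃ₗ[R] E', e.toLinearMap ∘ₗ φ = φ') ∧
      (∀ (E : Type (max u v)) [AddCommGroup E] [Module R E] (φ : M →ₗ[R] E),
        Coneat.IsConeatInjectiveEnvelope φ →
          Function.Injective φ ∧ Coneat.IsConeatSubmodule (LinearMap.range φ))) := by
  exact ⟨fun M _ _ => Coneat.isConeatInjective_iff_exists_simple_or_regular.{u, v} M,
    fun M _ _ => Coneat.isConeatInjective_iff_forall_isInjectiveWrt.{u, v} M,
    fun A B _ _ _ _ f => Coneat.isConeatMono_iff_forall_isInjectiveWrt.{u, v} f,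
    fun M _ _ => ⟨Coneat.exists_isConeatInjectiveEnvelope.{u, v} M,
      fun E E' _ _ _ _ φ φ' h h' => h.exists_equiv h',
      fun E _ _ φ h => h.injective_and_isConeatSubmodule⟩⟩
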